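/- **Theorem 3.6.** Let $\Gamma$ be a discrete group, not necessarily countable, that is amenable: for every finite $S\subseteq\Gamma$ and every $\varepsilon>0$ there is a non-empty finite $F\subseteq\Gamma$ with $|gF\,\triangle\,F|\le\varepsilon|F|$ for all $g\in S$. Let $C^*_r(\Gamma)$ be its reduced group $C^*$-algebra, the norm closure of the image of $\mathbb{C}[\Gamma]$ in $B(\ell^2(\Gamma))$ under the left regular representation. For a subgroup $X\le\Gamma$ let $\lambda_{\Gamma/X}\colon C^*_r(\Gamma)\to B(\ell^2(\Gamma/X))$ be the quasi-regular representation, that is, the continuous extension (which exists since $\Gamma$ is amenable) of $\lambda_{\Gamma/X}(g)\delta_{hX}=\delta_{ghX}$. Equip the set $\mathrm{Sub}(\Gamma)$ of all subgroups of $\Gamma$ with the Chabauty topology, induced by $X\mapsto \mathbf{1}_X\in\{0,1\}^\Gamma$ from the product topology. For a closed conjugation-invariant set $\mathcal{X}\subseteq\mathrm{Sub}(\Gamma)$ put $$J_{\Gamma,\mathcal{X}}=\bigcap_{X\in\mathcal{X}}\ker\lambda_{\Gamma/X}\trianglelefteq C^*_r(\Gamma),$$ and let $\mathcal{D}_\Gamma$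 be the collection of all closed conjugation-invariant $\mathcal{X}\subseteq\mathrm{Sub}(\Gamma)$ such that $J_{\Gamma,\mathcal{X}}\cap\mathbb{C}[\Gamma]$ is norm-dense in $J_{\Gamma,\mathcal{X}}$. These notions apply equally to each subgroup of $\Gamma$, which is again amenable. Let $\mathcal{X}\subseteq\mathrm{Sub}(\Gamma)$ be a closed and conjugation-invariant set of subgroups and let $\Lambda\le\Gamma$ be a subgroup such that $X\subseteq\Lambda$ for all $X\in\mathcal{X}$. Then $\mathcal{X}\in\mathcal{D}_\Gamma$ if and only if $\mathcal{X}$, viewed as a set of subgroups of $\Lambda$, belongs to $\mathcal{D}_\Lambda$. -/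

import Mathlib

open Classical in
/-- A (discrete) group is *amenable* if it satisfies the Følner condition: for every finite set `S`
and every `ε > 0` there is a non-empty finite set `F` with `|gF ∆ F| ≤ ε |F|` for all `g ∈ S`. -/
class AmenableGroup (Γ : Type*) [Group Γ] : Prop where
  folner : ∀ (S : Finset Γ) (ε : ℝ), 0 < ε → ∃ F : Finset Γ, F.Nonempty ∧
    ∀ g ∈ S, ((symmDiff (F.image (fun x => g * x)) F).card : ℝ) ≤ ε * (F.card : ℝ)

open Classical in
/-- Subgroups of amenable groups are amenable. -/
instance AmenableGroup.subgroup {Γ : Type*} [Group Γ] [AmenableGroup Γ] (Λ : Subgroup Γ) :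
    AmenableGroup Λ where
  folner S ε hε := by
    have hS : (0 : ℝ) < (S.card : ℝ) + 1 := by positivity
    obtain ⟨F, hne, hF⟩ := AmenableGroup.folner (S.image (fun g : Λ => (g : Γ)))
      (ε / (S.card + 1)) (by positivity)
    let q : Γ → Quotient (QuotientGroup.rightRel Λ) := fun x => Quotient.mk _ x
    have hq : ∀ x y, q x = q y ↔ y * x⁻¹ ∈ Λ := fun x y =>
      Quotient.eq.trans QuotientGroup.rightRel_apply
    have hqg : ∀ (g : Λ) x, q (g * x) = q x := fun g x => by
      rw [hq]
      simp
    let Fc : Quotient (QuotientGroup.rightRel Λ) → Finset Γ := fun c => F.filter fun x => q x = c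
    let D : Finset Γ → Λ → Finset Γ := fun A g => symmDiff (A.image (fun x => (g : Γ) * x)) A
    have hD : ∀ g c, (D F g).filter (fun x => q x = c) = D (Fc c) g := by
      intro g c
      ext x
      simp only [D, Fc, Finset.mem_filter, Finset.mem_symmDiff, Finset.mem_image]
      have h1 : (∃ a, (a ∈ F ∧ q a = c) ∧ (g : Γ) * a = x) ↔
          (∃ a ∈ F, (g : Γ) * a = x) ∧ q x = c := by
        constructor
        · rintro ⟨a, ⟨ha, hc⟩, rfl⟩
          exact ⟨⟨a, ha, rfl⟩, (hqg g a).trans hc⟩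
        · rintro ⟨⟨a, ha, rfl⟩, hc⟩
          exact ⟨a, ⟨ha, (hqg g a).symm.trans hc⟩, rfl⟩
      rw [h1]
      generalize (∃ a ∈ F, (g : Γ) * a = x) = P
      by_cases h2 : x ∈ F <;> by_cases h3 : q x = c <;> simp [h2, h3]
    have hcard : ∀ g, (D F g).card = ∑ c ∈ F.image q, (D (Fc c) g).card := by
      intro g
      rw [Finset.card_eq_sum_card_fiberwise (f := q) (t := F.image q)]
      · exact Finset.sum_congr rfl fun c _ => by rw [hD]
      · intro x hx
        have hx' : x ∈ symmDiff (F.image (fun x => (g : Γ) * x)) F := hx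
        rw [Finset.mem_symmDiff] at hx'
        rcases hx' with ⟨h, -⟩ | ⟨h, -⟩
        · obtain ⟨a, ha, rfl⟩ := Finset.mem_image.1 h
          exact Finset.mem_coe.2 (Finset.mem_image.2 ⟨a, ha, (hqg g a).symm⟩)
        · exact Finset.mem_coe.2 (Finset.mem_image_of_mem q h)
    have hcardF : F.card = ∑ c ∈ F.image q, (Fc c).card :=
      Finset.card_eq_sum_card_fiberwise fun x hx => Finset.mem_coe.2 (Finset.mem_image_of_mem q hx)
    have hsum : ∑ c ∈ F.image q, ∑ g ∈ S, ((D (Fc c) g).card : ℝ) ≤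
        ∑ c ∈ F.image q, ε * ((Fc c).card : ℝ) := by
      rw [Finset.sum_comm, ← Finset.mul_sum]
      have h1 : ∀ g ∈ S, ∑ c ∈ F.image q, ((D (Fc c) g).card : ℝ) ≤
          ε / (S.card + 1) * (F.card : ℝ) := by
        intro g hg
        have := hF g (Finset.mem_image_of_mem _ hg)
        rw [← Nat.cast_sum, ← hcard g]
        exact this
      refine (Finset.sum_le_sum h1).trans ?_
      rw [Finset.sum_const, nsmul_eq_mul, ← Nat.cast_sum, ← hcardF, ← mul_assoc]
      refine mul_le_mul_of_nonneg_right ?_ (Nat.cast_nonneg _)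
      rw [mul_div_assoc', div_le_iff₀ hS]
      nlinarith
    obtain ⟨c, hc, hle⟩ := Finset.exists_le_of_sum_le (hne.image q) hsum
    obtain ⟨t, ht, rfl⟩ := Finset.mem_image.1 hc
    let φ : Λ → Γ := fun l => (l : Γ) * t
    have hφ : Function.Injective φ := fun a b h => Subtype.ext (mul_right_cancel h)
    let F' : Finset Λ := (Fc (q t)).preimage φ hφ.injOn
    have himg : F'.image φ = Fc (q t) := by
      ext x
      simp only [F', Finset.mem_image, Finset.mem_preimage]
      constructor
      · rintro ⟨l, hl, rfl⟩
        exact hl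
      · intro hx
        have h2 : q t = q x := (Finset.mem_filter.1 hx).2.symm
        exact ⟨⟨x * t⁻¹, (hq t x).1 h2⟩, by simpa [φ] using hx, by simp [φ]⟩
    refine ⟨F', ?_, fun g hg => ?_⟩
    · have : (Fc (q t)).Nonempty := ⟨t, Finset.mem_filter.2 ⟨ht, rfl⟩⟩
      rw [← himg] at this
      exact Finset.image_nonempty.1 this
    · have h1 : (symmDiff (F'.image (fun x => g * x)) F').image φ = D (Fc (q t)) g := by
        rw [Finset.image_symmDiff _ _ hφ, himg]
        simp only [D]
        rw [← himg, Finset.image_image, Finset.image_image]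
        congr 2
        funext l
        simp [φ, mul_assoc]
      have h2 : ((symmDiff (F'.image (fun x => g * x)) F').card : ℝ) ≤ ε * (F'.card : ℝ) := by
        have h3 : (symmDiff (F'.image (fun x => g * x)) F').card = (D (Fc (q t)) g).card := by
          rw [← h1]
          exact (Finset.card_image_of_injective _ hφ).symm
        have h4 : F'.card = (Fc (q t)).card := by
          rw [← himg]
          exact (Finset.card_image_of_injective _ hφ).symm
        rw [h3, h4]
        exact (Finset.single_le_sum (f := fun g => ((D (Fc (q t)) g).card : ℝ))
          (fun _ _ => Nat.cast_nonneg _) hg).trans hle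
      convert h2

/-- The Hilbert space `ℓ²(S)`. -/
noncomputable abbrev Ell2 (S : Type*) := lp (fun _ : S => ℂ) 2

noncomputable section

namespace GroupCStar

open scoped ENNReal Topology

section Rep

variable {Γ : Type*} [Group Γ] (S : Type*) [MulAction Γ S]

theorem memlp_translate (g : Γ) (ξ : Ell2 S) :
    Memℓp (E := fun _ : S => ℂ) (fun s : S => ξ (g⁻¹ • s)) 2 := by
  have h2 : (0 : ℝ) < (2 : ℝ≥0∞).toReal := by norm_num
  have h := (lp.memℓp ξ).summable h2
  have h' : Summable fun s : S => ‖ξ (g⁻¹ • s)‖ ^ (2 : ℝ≥0∞).toReal :=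
    (MulAction.toPerm g⁻¹ : Equiv.Perm S).summable_iff
      (f := fun s => ‖ξ s‖ ^ (2 : ℝ≥0∞).toReal) |>.2 h
  exact memℓp_gen h'

/-- The unitary operator on `ℓ²(S)` given by `g`: `(g ξ)(s) = ξ(g⁻¹ s)`, that is `δ_s ↦ δ_{gs}`. -/
def translate (g : Γ) : Ell2 S →ₗᵢ[ℂ] Ell2 S where
  toFun ξ := ⟨fun s => ξ (g⁻¹ • s), memlp_translate S g ξ⟩
  map_add' _ _ := rfl
  map_smul' _ _ := rfl
  norm_map' ξ := by
    have h2 : (0 : ℝ) < (2 : ℝ≥0∞).toReal := by norm_num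
    rw [lp.norm_eq_tsum_rpow h2, lp.norm_eq_tsum_rpow h2]
    congr 1
    exact (MulAction.toPerm g⁻¹ : Equiv.Perm S).tsum_eq (fun s => ‖ξ s‖ ^ (2 : ℝ≥0∞).toReal)

@[simp] theorem translate_apply (g : Γ) (ξ : Ell2 S) (s : S) :
    translate S g ξ s = ξ (g⁻¹ • s) := rfl

/-- The permutation representation of `Γ` on `ℓ²(S)`. For `S = Γ` this is the left regular
representation, for `S = Γ ⧸ X` the quasi-regular representation. -/
def permRep : Γ →* (Ell2 S →L[ℂ] Ell2 S) where
  toFun g := (translate S g).toContinuousLinearMap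
  map_one' := by
    ext ξ s
    simp
  map_mul' g h := by
    ext ξ s
    simp [mul_smul]

@[simp] theorem permRep_apply (g : Γ) (ξ : Ell2 S) (s : S) :
    permRep S g ξ s = ξ (g⁻¹ • s) := rfl

/-- On the standard basis, `g δ_s = δ_{gs}`. -/
theorem permRep_single [DecidableEq S] (g : Γ) (s : S) :
    permRep S g (lp.single 2 s (1 : ℂ)) = lp.single 2 (g • s) (1 : ℂ) := by
  ext t
  simp only [permRep_apply, lp.single_apply, Pi.single_apply, inv_smul_eq_iff]

theorem star_permRep (g : Γ) : star (permRep S g) = permRep S g⁻¹ := by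
  rw [ContinuousLinearMap.star_eq_adjoint]
  symm
  rw [ContinuousLinearMap.eq_adjoint_iff]
  intro ξ η
  rw [lp.inner_eq_tsum, lp.inner_eq_tsum, ← (MulAction.toPerm g⁻¹).tsum_eq]
  simp

/-- The representation of the group algebra `ℂ[Γ]` on `ℓ²(S)` that extends `permRep` linearly. -/
def algRep : MonoidAlgebra ℂ Γ →ₐ[ℂ] (Ell2 S →L[ℂ] Ell2 S) :=
  MonoidAlgebra.lift ℂ (Ell2 S →L[ℂ] Ell2 S) Γ (permRep S)


theorem algRep_apply (f : MonoidAlgebra ℂ Γ) (ξ : Ell2 S) (s : S) :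
    algRep S f ξ s = ∑ g ∈ f.coeff.support, f.coeff g * ξ (g⁻¹ • s) := by
  rw [algRep, MonoidAlgebra.lift_apply, Finsupp.sum, sum_apply,
    lp.coeFn_sum, Finset.sum_apply]
  rfl

theorem algRep_single (g : Γ) (c : ℂ) :
    algRep S (MonoidAlgebra.single g c) = c • permRep S g := by
  simp [algRep]

theorem exists_star_algRep (f : MonoidAlgebra ℂ Γ) : ∃ f' : MonoidAlgebra ℂ Γ,
    algRep Γ f' = star (algRep Γ f) ∧ algRep S f' = star (algRep S f) := by
  induction f using MonoidAlgebra.induction_linear with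
  | zero => exact ⟨0, by simp⟩
  | add f g hf hg =>
    obtain ⟨f', h1, h2⟩ := hf
    obtain ⟨g', h3, h4⟩ := hg
    exact ⟨f' + g', by simp [*]⟩
  | single g c =>
    refine ⟨MonoidAlgebra.single g⁻¹ (star c), ?_, ?_⟩ <;>
      rw [algRep_single, algRep_single, star_smul, star_permRep]

end Rep

section Norm

theorem ell2_summable {S : Type*} (ξ : Ell2 S) : Summable fun s => ‖ξ s‖ ^ 2 := by
  have h2 : (0 : ℝ) < (2 : ℝ≥0∞).toReal := by norm_num
  have := (lp.memℓp ξ).summable h2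
  norm_num at this
  exact this

theorem ell2_norm_sq {S : Type*} (ξ : Ell2 S) : ‖ξ‖ ^ 2 = ∑' s, ‖ξ s‖ ^ 2 := by
  have h2 : (0 : ℝ) < (2 : ℝ≥0∞).toReal := by norm_num
  have := lp.norm_rpow_eq_tsum h2 ξ
  norm_num at this
  exact this

open Classical in
theorem ell2_sum_single {Γ : Type*} (F : Finset Γ) (z : Γ → ℂ) :
    ∃ ζ : Ell2 Γ, (∀ k, ζ k = if k ∈ F then z k else 0) ∧
      ‖ζ‖ ^ 2 = ∑ k ∈ F, ‖z k‖ ^ 2 := by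
  have hm : Memℓp (E := fun _ : Γ => ℂ) (fun k => if k ∈ F then z k else 0) 2 := by
    refine memℓp_gen (summable_of_ne_finset_zero (s := F) fun k hk => ?_)
    simp [hk]
  refine ⟨⟨_, hm⟩, fun k => rfl, ?_⟩
  rw [ell2_norm_sq, tsum_eq_sum (s := F)]
  · exact Finset.sum_congr rfl fun k hk => by simp [hk]
  · intro k hk
    simp [hk]

variable {Γ : Type*} [Group Γ] {S : Type*} [MulAction Γ S]

open Classical in
theorem folner_estimate (f : MonoidAlgebra ℂ Γ) (η : Ell2 S) (F F' : Finset Γ)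
    (hf : ∀ g ∈ f.coeff.support, ∀ h ∈ F', g⁻¹ * h ∈ F) :
    (F'.card : ℝ) * ‖algRep S f η‖ ^ 2 ≤ ‖algRep Γ f‖ ^ 2 * ((F.card : ℝ) * ‖η‖ ^ 2) := by
  choose ζ hζ hζn using fun s : S => ell2_sum_single F (fun k => η (k • s))
  have key : ∀ h ∈ F', ∀ s, algRep Γ f (ζ s) h = algRep S f η (h • s) := by
    intro h hh s
    rw [algRep_apply, algRep_apply]
    refine Finset.sum_congr rfl fun g hg => ?_
    have : g⁻¹ * h ∈ F := hf g hg h hh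
    rw [smul_eq_mul, hζ, if_pos this, mul_smul]
  have hs1 : ∀ (ξ : Ell2 S) (k : Γ), HasSum (fun s => ‖ξ (k • s)‖ ^ 2) (‖ξ‖ ^ 2) := by
    intro ξ k
    rw [ell2_norm_sq]
    exact (MulAction.toPerm k : Equiv.Perm S).hasSum_iff (f := fun s => ‖ξ s‖ ^ 2) |>.2
      (ell2_summable ξ).hasSum
  have hs2 := hasSum_sum (s := F') fun k _ => hs1 (algRep S f η) k
  have hs3 := (hasSum_sum (s := F) fun k _ => hs1 η k).mul_left (‖algRep Γ f‖ ^ 2)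
  simp only [Finset.sum_const, nsmul_eq_mul] at hs2 hs3
  refine hasSum_le (fun s => ?_) hs2 hs3
  calc ∑ h ∈ F', ‖algRep S f η (h • s)‖ ^ 2
      = ∑ h ∈ F', ‖algRep Γ f (ζ s) h‖ ^ 2 :=
        Finset.sum_congr rfl fun h hh => by rw [key h hh]
    _ ≤ ∑' h, ‖algRep Γ f (ζ s) h‖ ^ 2 :=
        (ell2_summable _).sum_le_tsum _ fun _ _ => by positivity
    _ = ‖algRep Γ f (ζ s)‖ ^ 2 := (ell2_norm_sq _).symm
    _ ≤ (‖algRep Γ f‖ * ‖ζ s‖) ^ 2 := by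
        gcongr
        exact ContinuousLinearMap.le_opNorm _ _
    _ = ‖algRep Γ f‖ ^ 2 * ∑ k ∈ F, ‖η (k • s)‖ ^ 2 := by rw [mul_pow, hζn]

variable (S) in
open Classical in
/-- For amenable `Γ`, every permutation representation is bounded by the regular one on `ℂ[Γ]`. -/
theorem norm_algRep_le [AmenableGroup Γ] (f : MonoidAlgebra ℂ Γ) :
    ‖algRep S f‖ ≤ ‖algRep Γ f‖ := by
  refine ContinuousLinearMap.opNorm_le_bound _ (norm_nonneg _) fun η => ?_
  refine (sq_le_sq₀ (norm_nonneg _) (by positivity)).1 ?_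
  rw [mul_pow]
  set n : ℝ := (f.coeff.support.card : ℝ)
  have hn : 0 ≤ n := Nat.cast_nonneg _
  have main : ∀ ε : ℝ, 0 < ε →
      (1 - n * ε) * ‖algRep S f η‖ ^ 2 ≤ ‖algRep Γ f‖ ^ 2 * ‖η‖ ^ 2 := by
    intro ε hε
    obtain ⟨F, hne, hF⟩ := AmenableGroup.folner f.coeff.support ε hε
    have hpos : (0 : ℝ) < F.card := by exact_mod_cast hne.card_pos
    let B : Finset Γ := f.coeff.support.biUnion fun g =>
      symmDiff (F.image (fun x => g * x)) F
    have hB : (B.card : ℝ) ≤ n * ε * F.card := by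
      calc (B.card : ℝ) ≤ ∑ g ∈ f.coeff.support,
            ((symmDiff (F.image (fun x => g * x)) F).card : ℝ) := by
            exact_mod_cast Finset.card_biUnion_le
        _ ≤ ∑ g ∈ f.coeff.support, ε * (F.card : ℝ) := Finset.sum_le_sum hF
        _ = n * ε * F.card := by rw [Finset.sum_const, nsmul_eq_mul, mul_assoc]
    have h1 := folner_estimate f η F (F \ B) (by
      intro g hg h hh
      rw [Finset.mem_sdiff] at hh
      by_contra hc
      refine hh.2 (Finset.mem_biUnion.2 ⟨g, hg, ?_⟩)
      rw [Finset.mem_symmDiff]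
      refine Or.inr ⟨hh.1, fun h' => ?_⟩
      obtain ⟨x, hx, rfl⟩ := Finset.mem_image.1 h'
      exact hc (by simpa using hx))
    have h2 : (1 - n * ε) * F.card ≤ ((F \ B).card : ℝ) := by
      have : (F.card : ℝ) ≤ (F \ B).card + B.card := by
        exact_mod_cast (Nat.sub_le_iff_le_add.1 (Finset.le_card_sdiff B F))
      linarith
    have h3 : (F.card : ℝ) * ((1 - n * ε) * ‖algRep S f η‖ ^ 2) ≤
        (F.card : ℝ) * (‖algRep Γ f‖ ^ 2 * ‖η‖ ^ 2) := by
      have := mul_le_mul_of_nonneg_right h2 (sq_nonneg ‖algRep S f η‖)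
      linarith
    exact le_of_mul_le_mul_left h3 hpos
  have ht : Filter.Tendsto (fun ε : ℝ => (1 - n * ε) * ‖algRep S f η‖ ^ 2)
      (nhdsWithin 0 (Set.Ioi 0)) (nhds ((1 - n * 0) * ‖algRep S f η‖ ^ 2)) :=
    (Continuous.tendsto (by fun_prop) 0).mono_left nhdsWithin_le_nhds
  have := le_of_tendsto ht (Filter.eventually_of_mem self_mem_nhdsWithin fun ε hε => main ε hε)
  simpa using this

end Norm

section Extension

variable {E A B : Type*} [Ring E] [Algebra ℂ E] [NormedRing A] [StarRing A] [NormedAlgebra ℂ A]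
  [ContinuousStar A] [NormedRing B] [StarRing B] [NormedAlgebra ℂ B] [ContinuousStar B]

/-- A continuous linear map that extends, from a dense image, a representation compatible with the
adjoint is a `*`-homomorphism. -/
def extStarAlgHom (e : E →ₐ[ℂ] A) (he : DenseRange e) (f : E →ₐ[ℂ] B) (T : A →L[ℂ] B)
    (hT : ∀ x, T (e x) = f x) (hs : ∀ x, ∃ y, e y = star (e x) ∧ f y = star (f x)) :
    A →⋆ₐ[ℂ] B where
  toFun := T
  map_one' := by rw [← map_one e, hT, map_one]
  map_mul' a b := by
    refine he.induction_on₂ (p := fun a b => T (a * b) = T a * T b) ?_ ?_ a b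
    · exact isClosed_eq (by fun_prop) (by fun_prop)
    · intro f g
      rw [← map_mul, hT, hT, hT, map_mul]
  map_zero' := map_zero T
  map_add' := map_add T
  commutes' c := by rw [← AlgHom.commutes e, hT, AlgHom.commutes]
  map_star' a := by
    refine he.induction_on (p := fun a => T (star a) = star (T a)) a ?_ ?_
    · exact isClosed_eq (by fun_prop) (by fun_prop)
    · intro x
      obtain ⟨y, h1, h2⟩ := hs x
      rw [← h1, hT, hT, h2]

theorem continuous_extStarAlgHom (e : E →ₐ[ℂ] A) (he : DenseRange e) (f : E →ₐ[ℂ] B)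
    (T : A →L[ℂ] B) (hT : ∀ x, T (e x) = f x)
    (hs : ∀ x, ∃ y, e y = star (e x) ∧ f y = star (f x)) :
    Continuous (extStarAlgHom e he f T hT hs) := T.continuous

end Extension

section Reduced

variable (Γ : Type*) [Group Γ]

/-- The image of the group algebra `ℂ[Γ]` in `B(ℓ²(Γ))` under the left regular representation. -/
def regularImage : StarSubalgebra ℂ (Ell2 Γ →L[ℂ] Ell2 Γ) where
  toSubalgebra := (algRep Γ : MonoidAlgebra ℂ Γ →ₐ[ℂ] _).range
  star_mem' := by
    rintro _ ⟨f, rfl⟩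
    obtain ⟨f', h, -⟩ := exists_star_algRep Γ f
    exact ⟨f', h⟩

/-- The reduced group C*-algebra `C*_r(Γ)`: the norm closure of `ℂ[Γ]` in `B(ℓ²(Γ))`. -/
def ReducedCStar : StarSubalgebra ℂ (Ell2 Γ →L[ℂ] Ell2 Γ) :=
  (regularImage Γ).topologicalClosure

/-- The canonical embedding `ℂ[Γ] → C*_r(Γ)`. -/
def toReduced : MonoidAlgebra ℂ Γ →ₐ[ℂ] ReducedCStar Γ where
  toFun f := ⟨algRep Γ f, (regularImage Γ).le_topologicalClosure ⟨f, rfl⟩⟩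
  map_one' := Subtype.ext (map_one (algRep Γ))
  map_mul' f g := Subtype.ext (map_mul (algRep Γ) f g)
  map_zero' := Subtype.ext (map_zero (algRep Γ))
  map_add' f g := Subtype.ext (map_add (algRep Γ) f g)
  commutes' c := Subtype.ext ((algRep Γ : MonoidAlgebra ℂ Γ →ₐ[ℂ] _).commutes c)

theorem coe_toReduced (f : MonoidAlgebra ℂ Γ) :
    (toReduced Γ f : Ell2 Γ →L[ℂ] Ell2 Γ) = algRep Γ f := rfl

theorem denseRange_toReduced : DenseRange (toReduced Γ) := by
  rintro ⟨a, ha⟩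
  rw [closure_subtype]
  convert (show a ∈ closure (regularImage Γ : Set (Ell2 Γ →L[ℂ] Ell2 Γ)) from ha) using 2
  ext b
  constructor
  · rintro ⟨_, ⟨f, rfl⟩, rfl⟩
    exact ⟨f, rfl⟩
  · rintro ⟨f, rfl⟩
    exact ⟨_, ⟨f, rfl⟩, rfl⟩

variable {Γ} [AmenableGroup Γ]

theorem norm_algRep_le_toReduced (S : Type*) [MulAction Γ S] (f : MonoidAlgebra ℂ Γ) :
    ‖(algRep S).toLinearMap f‖ ≤ 1 * ‖(toReduced Γ).toLinearMap f‖ := by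
  rw [one_mul]
  exact norm_algRep_le S f

/-- The continuous linear extension to `C*_r(Γ)`, for amenable `Γ`, of the representation of `ℂ[Γ]`
on `ℓ²(S)`. -/
def extRep (S : Type*) [MulAction Γ S] : ReducedCStar Γ →L[ℂ] (Ell2 S →L[ℂ] Ell2 S) :=
  (algRep S).toLinearMap.extendOfNorm (toReduced Γ).toLinearMap

theorem extRep_toReduced (S : Type*) [MulAction Γ S] (f : MonoidAlgebra ℂ Γ) :
    extRep S (toReduced Γ f) = algRep S f := by
  have hd : DenseRange (toReduced Γ).toLinearMap := denseRange_toReduced Γ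
  have h := LinearMap.extendOfNorm_eq (f := (algRep S).toLinearMap) hd
    ⟨1, norm_algRep_le_toReduced S⟩ f
  rw [AlgHom.toLinearMap_apply, AlgHom.toLinearMap_apply] at h
  exact h

/-- The quasi-regular representation `λ_{Γ/X}` of `C*_r(Γ)` on `ℓ²(Γ/X)`, for amenable `Γ`: the
`*`-homomorphism that extends `g ↦ (δ_{hX} ↦ δ_{ghX})` continuously. -/
def quasiRegular (X : Subgroup Γ) : ReducedCStar Γ →⋆ₐ[ℂ] (Ell2 (Γ ⧸ X) →L[ℂ] Ell2 (Γ ⧸ X)) :=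
  extStarAlgHom (toReduced Γ) (denseRange_toReduced Γ) (algRep (Γ ⧸ X)) (extRep (Γ ⧸ X))
    (extRep_toReduced (Γ ⧸ X)) fun f => by
      obtain ⟨f', h1, h2⟩ := exists_star_algRep (Γ ⧸ X) f
      exact ⟨f', Subtype.ext h1, h2⟩

theorem quasiRegular_apply (X : Subgroup Γ) (a : ReducedCStar Γ) :
    quasiRegular X a = extRep (Γ ⧸ X) a := rfl

theorem quasiRegular_toReduced (X : Subgroup Γ) (f : MonoidAlgebra ℂ Γ) :
    quasiRegular X (toReduced Γ f) = algRep (Γ ⧸ X) f := by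
  rw [quasiRegular_apply, extRep_toReduced]

theorem continuous_quasiRegular (X : Subgroup Γ) : Continuous (quasiRegular X) := by
  unfold quasiRegular
  exact continuous_extStarAlgHom _ _ _ _ _ _

end Reduced

section Density

variable (Γ : Type*) [Group Γ]

open Classical in
/-- The Chabauty topology on `Sub(Γ)`, induced by `X ↦ 1_X ∈ {0,1}^Γ` with the product topology. -/
@[reducible] def chabauty : TopologicalSpace (Subgroup Γ) :=
  TopologicalSpace.induced (fun X (g : Γ) => decide (g ∈ X)) (inferInstance :
    TopologicalSpace (Γ → Bool))

variable {Γ}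

/-- Invariance of a set of subgroups under `X ↦ gXg⁻¹`. -/
def ConjInvariant (𝒳 : Set (Subgroup Γ)) : Prop :=
  ∀ g : Γ, ∀ X ∈ 𝒳, X.map (MulAut.conj g).toMonoidHom ∈ 𝒳

/-- The ideal `J_{Γ,𝒳}` of `C*_r(Γ)`: the intersection of the kernels of `λ_{Γ/X}`, `X ∈ 𝒳`. -/
def J [AmenableGroup Γ] (𝒳 : Set (Subgroup Γ)) : Ideal (ReducedCStar Γ) :=
  ⨅ X ∈ 𝒳, RingHom.ker (quasiRegular X)

variable (Γ) in
/-- `𝒟_Γ`: the closed conjugation-invariant sets `𝒳` of subgroups of the amenable group `Γ` such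
that `J_{Γ,𝒳} ∩ ℂ[Γ]` is dense in `J_{Γ,𝒳}`. -/
def DensityClass [AmenableGroup Γ] : Set (Set (Subgroup Γ)) :=
  {𝒳 | IsClosed[chabauty Γ] 𝒳 ∧ ConjInvariant 𝒳 ∧
    (J 𝒳 : Set (ReducedCStar Γ)) ⊆
      closure ((J 𝒳 : Set (ReducedCStar Γ)) ∩ Set.range (toReduced Γ))}

end Density

end GroupCStar

end

/-! For subgroups `H ≤ G`, restricting coefficients to `H` extends to a contraction `E : C*_r(G) →
C*_r(H)`, which is a left inverse of the inclusion `ι` and sends `ℂ[G]` into `ℂ[H]`. If every `X ∈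
𝒳` lies in `H`, the functional `⟨λ_{G/X}(a) δ_X, δ_X⟩`, which sums the coefficients of `a` over `X`,
factors through `E`. Conjugation invariance makes these functionals, applied to all left translates
of `a`, detect membership in `J`; hence `E` and `ι` carry the two ideals `J` into each other. To
pass density down from `G` to `H`, approximate `ι b` in `J_G` and apply `E`.

For the converse, let `N` be the subgroup generated by all members of `𝒳`. It is normal in `Γ` and
contained in `Λ`, so density descends from `Λ` to `N`, and it remains to climb from `N` to `Γ`.
Almost invariant finitely supported unit vectors `ξ ∈ ℓ²(Γ/N)` give positive definite functions
`ψ(g) = ⟨ξ, gξ⟩` that are finitely supported on `Γ/N` and close to 1 on a given finite set. The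
corresponding Herz–Schur multipliers are contractive, so `a` is a norm limit of finite sums of `ψ(c)
u_c ι(E(u_c⁻¹ a))` over cosets `c`. For `a ∈ J` each `E(u_c⁻¹ a)` lies in the ideal of `N`, where
approximation by algebra elements is available.

The carrying lemmas are `mem_J_iff`, `coeff_condExp`, `norm_multiplier_le` and
`exists_almost_invariant`. -/

noncomputable section

namespace GroupCStar

open scoped ENNReal Topology

/-! ### Group elements as generators of the reduced algebra -/

section Generators

variable {G : Type*} [Group G]

/-- The canonical unitary of `C*_r(G)` attached to a group element. -/
def unit (g : G) : ReducedCStar G := toReduced G (MonoidAlgebra.single g 1)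

theorem unit_mul (g h : G) : unit g * unit h = unit (g * h) := by
  rw [unit, unit, ← map_mul, MonoidAlgebra.single_mul_single, one_mul, unit]

theorem toReduced_single (g : G) (c : ℂ) :
    toReduced G (MonoidAlgebra.single g c) = c • unit g := by
  rw [unit, ← map_smul, MonoidAlgebra.smul_single, smul_eq_mul, mul_one]

theorem norm_toReduced (f : MonoidAlgebra ℂ G) : ‖toReduced G f‖ = ‖algRep G f‖ := rfl

theorem coe_unit (g : G) : ((unit g : ReducedCStar G) : Ell2 G →L[ℂ] Ell2 G) = permRep G g := by
  rw [unit, coe_toReduced, algRep_single, one_smul]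

theorem norm_unit_le (g : G) : ‖unit g‖ ≤ 1 := by
  change ‖((unit g : ReducedCStar G) : Ell2 G →L[ℂ] Ell2 G)‖ ≤ 1
  rw [coe_unit]
  exact (translate G g).norm_toContinuousLinearMap_le

/-- Continuous linear maps on `C*_r(G)` that agree on group elements are equal. -/
theorem reduced_ext {M : Type*} [NormedAddCommGroup M] [NormedSpace ℂ M]
    {T₁ T₂ : ReducedCStar G →L[ℂ] M} (h : ∀ g, T₁ (unit g) = T₂ (unit g)) : T₁ = T₂ := by
  refine ContinuousLinearMap.ext fun a => ?_
  refine (denseRange_toReduced G).induction_on (p := fun a => T₁ a = T₂ a) a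
    (isClosed_eq T₁.continuous T₂.continuous) fun f => ?_
  induction f using MonoidAlgebra.induction_linear with
  | zero => simp
  | add f g hf hg => simp [hf, hg]
  | single g c => rw [toReduced_single, map_smul, map_smul, h]

/-- Completeness of the target is what extension by density into `C*_r(G)` relies on. -/
instance : CompleteSpace (ReducedCStar G) :=
  ((regularImage G).isClosed_topologicalClosure).completeSpace_coe

end Generators

/-! ### Inclusions and conditional expectations -/

section Functoriality

variable {G H : Type*} [Group G] [Group H]

theorem algRep_mapDomain (φ : H →* G) (f : MonoidAlgebra ℂ H) :
    algRep G (MonoidAlgebra.mapDomainAlgHom ℂ ℂ φ f) =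
      @algRep H _ G (MulAction.compHom G φ) f := by
  let := MulAction.compHom G φ
  induction f using MonoidAlgebra.induction_linear with
  | zero => rw [map_zero, map_zero, map_zero]
  | add f g hf hg => rw [map_add, map_add, map_add, hf, hg]
  | single h c =>
    rw [algRep_single, MonoidAlgebra.mapDomainAlgHom_apply, MonoidAlgebra.mapDomain_single,
      algRep_single]
    congr 1
    ext ξ s
    rw [permRep_apply, permRep_apply, ← map_inv]
    rfl

/-- Through `φ`, the space `ℓ²(G)` is a permutation representation of `H`, and amenability of `H`
bounds it by the regular one. -/
theorem norm_algRep_mapDomain_le [AmenableGroup H] (φ : H →* G) (f : MonoidAlgebra ℂ H) :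
    ‖toReduced G (MonoidAlgebra.mapDomainAlgHom ℂ ℂ φ f)‖ ≤ 1 * ‖toReduced H f‖ := by
  rw [norm_toReduced, norm_toReduced, algRep_mapDomain, one_mul]
  let := MulAction.compHom G φ
  exact norm_algRep_le G f

/-- The map `C*_r(H) → C*_r(G)` induced by a homomorphism out of an amenable group `H`. -/
def reducedMap (φ : H →* G) : ReducedCStar H →L[ℂ] ReducedCStar G :=
  ((toReduced G).toLinearMap ∘ₗ (MonoidAlgebra.mapDomainAlgHom ℂ ℂ φ).toLinearMap).extendOfNorm
    (toReduced H).toLinearMap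

theorem reducedMap_toReduced [AmenableGroup H] (φ : H →* G) (f : MonoidAlgebra ℂ H) :
    reducedMap φ (toReduced H f) = toReduced G (MonoidAlgebra.mapDomainAlgHom ℂ ℂ φ f) :=
  LinearMap.extendOfNorm_eq
    (f := (toReduced G).toLinearMap ∘ₗ (MonoidAlgebra.mapDomainAlgHom ℂ ℂ φ).toLinearMap)
    (e := (toReduced H).toLinearMap) (denseRange_toReduced H)
    ⟨1, norm_algRep_mapDomain_le φ⟩ f

theorem reducedMap_unit [AmenableGroup H] (φ : H →* G) (h : H) :
    reducedMap φ (unit h) = unit (φ h) := by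
  rw [unit, reducedMap_toReduced, MonoidAlgebra.mapDomainAlgHom_apply,
    MonoidAlgebra.mapDomain_single, unit]

/-- Extension by zero along an injective map is an isometry `ℓ²(A) → ℓ²(B)`. -/
theorem exists_ell2_extend {A B : Type*} {φ : A → B} (hφ : Function.Injective φ) (ξ : Ell2 A) :
    ∃ ζ : Ell2 B, (∀ a, ζ (φ a) = ξ a) ∧ (∀ b, b ∉ Set.range φ → ζ b = 0) ∧ ‖ζ‖ = ‖ξ‖ := by
  have h0 : ∀ b, b ∉ Set.range φ → Function.extend φ ξ 0 b = 0 := fun b hb =>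
    Function.extend_apply' _ _ _ hb
  have h1 : ∀ a, Function.extend φ ξ 0 (φ a) = ξ a := fun a => hφ.extend_apply _ _ _
  have hm : Memℓp (E := fun _ : B => ℂ) (Function.extend φ ξ 0) 2 := by
    refine memℓp_gen ?_
    rw [← hφ.summable_iff fun b hb => by simp [h0 b hb]]
    refine (ell2_summable ξ).congr fun a => ?_
    simp [h1]
  refine ⟨⟨_, hm⟩, h1, h0, ?_⟩
  rw [← sq_eq_sq₀ (norm_nonneg _) (norm_nonneg _), ell2_norm_sq, ell2_norm_sq,
    ← hφ.tsum_eq]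
  · exact tsum_congr fun a => by rw [← h1]
  · intro b hb
    by_contra hc
    exact hb (by simp [h0 b hc])

/-- The restricted element acts as the compression of `f` to the copy of `ℓ²(H)` inside `ℓ²(G)`. No
amenability is needed. -/
theorem norm_algRep_comapDomain_le (φ : H →* G) (hφ : Function.Injective φ)
    (f : MonoidAlgebra ℂ G) :
    ‖algRep H (MonoidAlgebra.comapDomain φ hφ f)‖ ≤ ‖algRep G f‖ := by
  refine ContinuousLinearMap.opNorm_le_bound _ (norm_nonneg _) fun ξ => ?_
  obtain ⟨ζ, h1, h0, hn⟩ := exists_ell2_extend hφ ξ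
  have key : ∀ h, algRep H (MonoidAlgebra.comapDomain φ hφ f) ξ h = algRep G f ζ (φ h) := by
    intro h
    induction f using MonoidAlgebra.induction_linear with
    | zero => simp
    | add f g hf hg =>
      rw [MonoidAlgebra.comapDomain_add, map_add, map_add]
      exact congrArg₂ (· + ·) hf hg
    | single g c =>
      by_cases hg : g ∈ Set.range φ
      · obtain ⟨k, rfl⟩ := hg
        rw [MonoidAlgebra.comapDomain_single_map, algRep_single, algRep_single]
        change c * ξ (k⁻¹ * h) = c * ζ ((φ k)⁻¹ * φ h)
        rw [← map_inv, ← map_mul, h1]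
      · rw [MonoidAlgebra.comapDomain_single_of_not_mem_range hg, map_zero, algRep_single]
        change 0 = c * ζ (g⁻¹ * φ h)
        rw [h0, mul_zero]
        rintro ⟨k, hk⟩
        exact hg ⟨h * k⁻¹, by rw [map_mul, map_inv, hk]; group⟩
  rw [← hn]
  refine le_trans ?_ ((algRep G f).le_opNorm ζ)
  rw [← sq_le_sq₀ (norm_nonneg _) (norm_nonneg _), ell2_norm_sq, ell2_norm_sq]
  refine Summable.tsum_le_tsum_of_inj φ hφ (fun _ _ => by positivity) (fun h => by rw [key])
    (ell2_summable _) (ell2_summable _)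

/-- Restriction of coefficients along an injective homomorphism. -/
def comapLinear (φ : H →* G) (hφ : Function.Injective φ) :
    MonoidAlgebra ℂ G →ₗ[ℂ] MonoidAlgebra ℂ H where
  toFun := MonoidAlgebra.comapDomain φ hφ
  map_add' := MonoidAlgebra.comapDomain_add φ hφ
  map_smul' c f := by ext; simp

theorem norm_comapLinear_le (φ : H →* G) (hφ : Function.Injective φ) (f : MonoidAlgebra ℂ G) :
    ‖((toReduced H).toLinearMap ∘ₗ comapLinear φ hφ) f‖ ≤ 1 * ‖(toReduced G).toLinearMap f‖ := by
  rw [one_mul]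
  exact norm_algRep_comapDomain_le φ hφ f

/-- The conditional expectation `C*_r(G) → C*_r(H)` for an injective homomorphism `H → G`. -/
def condExp (φ : H →* G) (hφ : Function.Injective φ) : ReducedCStar G →L[ℂ] ReducedCStar H :=
  ((toReduced H).toLinearMap ∘ₗ comapLinear φ hφ).extendOfNorm (toReduced G).toLinearMap

variable (φ : H →* G) (hφ : Function.Injective φ)

theorem condExp_toReduced (f : MonoidAlgebra ℂ G) :
    condExp φ hφ (toReduced G f) = toReduced H (MonoidAlgebra.comapDomain φ hφ f) :=
  LinearMap.extendOfNorm_eq (f := (toReduced H).toLinearMap ∘ₗ comapLinear φ hφ)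
    (e := (toReduced G).toLinearMap) (denseRange_toReduced G) ⟨1, norm_comapLinear_le φ hφ⟩ f

theorem condExp_unit_map (h : H) : condExp φ hφ (unit (φ h)) = unit h := by
  rw [unit, condExp_toReduced, MonoidAlgebra.comapDomain_single_map, unit]

theorem condExp_unit_of_notMem {g : G} (hg : g ∉ Set.range φ) :
    condExp φ hφ (unit g) = 0 := by
  rw [unit, condExp_toReduced, MonoidAlgebra.comapDomain_single_of_not_mem_range hg, map_zero]

/-- Left multiplication by a fixed element of `C*_r(G)`. -/
def mulLeftCLM (a : ReducedCStar G) : ReducedCStar G →L[ℂ] ReducedCStar G :=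
  ContinuousLinearMap.mul ℂ (ReducedCStar G) a

@[simp] theorem mulLeftCLM_apply (a b : ReducedCStar G) : mulLeftCLM a b = a * b := rfl

theorem condExp_unit_mul (h : H) (a : ReducedCStar G) :
    condExp φ hφ (unit (φ h) * a) = unit h * condExp φ hφ a := by
  have := reduced_ext (T₁ := condExp φ hφ ∘L mulLeftCLM (unit (φ h)))
    (T₂ := mulLeftCLM (unit h) ∘L condExp φ hφ) fun g => by
      simp only [ContinuousLinearMap.comp_apply, mulLeftCLM_apply, unit_mul]
      by_cases hg : g ∈ Set.range φ
      · obtain ⟨k, rfl⟩ := hg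
        rw [← map_mul, condExp_unit_map, condExp_unit_map, unit_mul]
      · rw [condExp_unit_of_notMem φ hφ hg, mul_zero, condExp_unit_of_notMem]
        rintro ⟨k, hk⟩
        exact hg ⟨h⁻¹ * k, by rw [map_mul, map_inv, hk]; group⟩
  exact congrArg (fun T => T a) this

theorem condExp_reducedMap [AmenableGroup H] (b : ReducedCStar H) :
    condExp φ hφ (reducedMap φ b) = b := by
  have := reduced_ext (T₁ := condExp φ hφ ∘L reducedMap φ)
    (T₂ := ContinuousLinearMap.id ℂ _) fun h => by simp [reducedMap_unit, condExp_unit_map]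
  exact congrArg (fun T => T b) this

/-- The product is supported on the coset `g φ(H)`, which misses `φ(H)`. -/
theorem condExp_unit_mul_reducedMap_of_notMem [AmenableGroup H] {g : G} (hg : g ∉ Set.range φ)
    (b : ReducedCStar H) : condExp φ hφ (unit g * reducedMap φ b) = 0 := by
  have := reduced_ext (T₁ := condExp φ hφ ∘L mulLeftCLM (unit g) ∘L reducedMap φ)
    (T₂ := 0) fun h => by
      simp only [ContinuousLinearMap.comp_apply, mulLeftCLM_apply, reducedMap_unit, unit_mul,
        zero_apply]
      refine condExp_unit_of_notMem φ hφ ?_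
      rintro ⟨k, hk⟩
      exact hg ⟨k * h⁻¹, by rw [map_mul, map_inv, hk]; group⟩
  exact congrArg (fun T => T b) this

end Functoriality

/-! ### Matrix coefficients and membership in `J` -/

section Coefficients

theorem mem_map_conj {G : Type*} [Group G] {X : Subgroup G} {g x : G} :
    x ∈ X.map (MulAut.conj g).toMonoidHom ↔ g⁻¹ * x * g ∈ X := by
  constructor
  · rintro ⟨y, hy, rfl⟩
    simpa [mul_assoc] using hy
  · intro hx
    exact ⟨_, hx, by simp [mul_assoc]⟩

variable {G : Type*} [Group G] [AmenableGroup G]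

theorem quasiRegular_unit (X : Subgroup G) (g : G) :
    quasiRegular X (unit g) = permRep (G ⧸ X) g := by
  rw [unit, quasiRegular_toReduced, algRep_single, one_smul]

open Classical in
/-- The matrix coefficient `⟨λ_{G/X}(a) δ_{hX}, δ_{kX}⟩`. -/
def coeff (X : Subgroup G) (h k : G) : ReducedCStar G →L[ℂ] ℂ :=
  lp.evalCLM ℂ (fun _ : G ⧸ X => ℂ) 2 (k : G ⧸ X) ∘L
    ContinuousLinearMap.apply ℂ (Ell2 (G ⧸ X)) (lp.single 2 (h : G ⧸ X) (1 : ℂ)) ∘L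
      extRep (G ⧸ X)

open Classical in
theorem coeff_apply (X : Subgroup G) (h k : G) (a : ReducedCStar G) :
    coeff X h k a = quasiRegular X a (lp.single 2 (h : G ⧸ X) (1 : ℂ)) (k : G ⧸ X) := rfl

open Classical in
theorem coeff_unit (X : Subgroup G) (h k g : G) :
    coeff X h k (unit g) = if k⁻¹ * g * h ∈ X then 1 else 0 := by
  rw [coeff_apply, quasiRegular_unit, permRep_single, lp.single_apply, Pi.single_apply]
  refine if_congr ?_ rfl rfl
  change (k : G ⧸ X) = ((g * h : G) : G ⧸ X) ↔ _
  rw [QuotientGroup.eq, mul_assoc]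

/-- Matrix coefficients are determined by those at the base point of a conjugate subgroup. -/
theorem coeff_eq_conj (X : Subgroup G) (h k : G) (a : ReducedCStar G) :
    coeff X h k a = coeff (X.map (MulAut.conj h).toMonoidHom) 1 1 (unit (h * k⁻¹) * a) := by
  classical
  have := reduced_ext (G := G) (T₁ := coeff X h k)
    (T₂ := (coeff (X.map (MulAut.conj h).toMonoidHom) 1 1).comp (mulLeftCLM (unit (h * k⁻¹))))
    fun g => by
      rw [ContinuousLinearMap.comp_apply, mulLeftCLM_apply, unit_mul, coeff_unit, coeff_unit,
        mem_map_conj]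
      refine if_congr ?_ rfl rfl
      simp [mul_assoc]
  exact congrArg (fun T => T a) this

theorem coeff_unit_mul (X : Subgroup G) (g h k : G) (a : ReducedCStar G) :
    coeff X h k (unit g * a) = coeff X h (g⁻¹ * k) a := by
  rw [coeff_apply, map_mul, quasiRegular_unit]
  rfl

theorem quasiRegular_eq_zero_iff (X : Subgroup G) (a : ReducedCStar G) :
    quasiRegular X a = 0 ↔ ∀ h k, coeff X h k a = 0 := by
  classical
  constructor
  · intro ha h k
    rw [coeff_apply, ha]
    rfl
  · intro ha
    refine ContinuousLinearMap.ext fun ξ => ?_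
    have h1 : ∀ c : G ⧸ X, quasiRegular X a (lp.single 2 c (ξ c)) = 0 := by
      intro c
      have h2 : quasiRegular X a (lp.single 2 c (1 : ℂ)) = 0 := by
        ext d
        obtain ⟨h, rfl⟩ := QuotientGroup.mk_surjective c
        obtain ⟨k, rfl⟩ := QuotientGroup.mk_surjective d
        convert ha h k
        rw [coeff_apply]
        congr!
      have h3 : lp.single (E := fun _ : G ⧸ X => ℂ) 2 c (ξ c) =
          ξ c • lp.single (E := fun _ : G ⧸ X => ℂ) 2 c (1 : ℂ) := by
        rw [← lp.single_smul, smul_eq_mul, mul_one]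
      rw [h3, map_smul, h2, smul_zero]
    have h4 := (lp.hasSum_single (by norm_num) ξ).mapL (quasiRegular X a)
    simp only [h1] at h4
    exact h4.unique hasSum_zero

/-- Moving the base point of `G/X` replaces `X` by a conjugate, which is again in `𝒳`. So only
base-point coefficients of left translates remain, the form in which conditional expectations can be
compared. -/
theorem mem_J_iff {𝒳 : Set (Subgroup G)} (h𝒳 : ConjInvariant 𝒳) (a : ReducedCStar G) :
    a ∈ J 𝒳 ↔ ∀ X ∈ 𝒳, ∀ g, coeff X 1 1 (unit g * a) = 0 := by
  simp only [J, Submodule.mem_iInf, RingHom.mem_ker, quasiRegular_eq_zero_iff]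
  constructor
  · intro h X hX g
    rw [coeff_unit_mul]
    exact h X hX _ _
  · intro h X hX x y
    rw [coeff_eq_conj]
    exact h _ (h𝒳 x X hX) _

end Coefficients

/-! ### Descent of density to a subgroup -/

section Restriction

variable {G H : Type*} [Group G] [Group H]

theorem ConjInvariant.comap {𝒳 : Set (Subgroup G)} (h𝒳 : ConjInvariant 𝒳) (φ : H →* G) :
    ConjInvariant (Subgroup.comap φ '' 𝒳) := by
  rintro h _ ⟨X, hX, rfl⟩
  refine ⟨_, h𝒳 (φ h) X hX, ?_⟩
  ext x
  constructor
  · rintro ⟨y, hy, he⟩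
    refine ⟨h⁻¹ * x * h, ?_, by simp [mul_assoc]⟩
    change φ (h⁻¹ * x * h) ∈ X
    have he' : φ h * y * (φ h)⁻¹ = φ x := he
    rw [map_mul, map_mul, map_inv, ← he']
    simpa [mul_assoc] using hy
  · rintro ⟨y, hy, rfl⟩
    exact ⟨φ y, hy, by simp⟩

variable [AmenableGroup G] [AmenableGroup H] (φ : H →* G)

/-- The base-point coefficient sums over `X` only, so discarding the coefficients outside `φ(H) ⊇ X`
does not change it. -/
theorem coeff_condExp (hφ : Function.Injective φ) {X : Subgroup G} (hX : X ≤ φ.range)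
    (a : ReducedCStar G) :
    coeff (X.comap φ) 1 1 (condExp φ hφ a) = coeff X 1 1 a := by
  classical
  have := reduced_ext (T₁ := coeff (X.comap φ) 1 1 ∘L condExp φ hφ) (T₂ := coeff X 1 1)
    fun g => by
      rw [ContinuousLinearMap.comp_apply]
      by_cases hg : g ∈ Set.range φ
      · obtain ⟨k, rfl⟩ := hg
        rw [condExp_unit_map, coeff_unit, coeff_unit]
        refine if_congr ?_ rfl rfl
        rw [Subgroup.mem_comap, map_mul, map_mul, map_inv, map_one]
      · rw [condExp_unit_of_notMem φ hφ hg, map_zero, coeff_unit, if_neg]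
        intro h
        exact hg (hX (by simpa using h))
  exact congrArg (fun T => T a) this

variable {𝒳 : Set (Subgroup G)}

theorem condExp_mem_J (hφ : Function.Injective φ) (h𝒳 : ConjInvariant 𝒳)
    (hle : ∀ X ∈ 𝒳, X ≤ φ.range) {a : ReducedCStar G} (ha : a ∈ J 𝒳) :
    condExp φ hφ a ∈ J (Subgroup.comap φ '' 𝒳) := by
  rw [mem_J_iff (h𝒳.comap φ)]
  rintro _ ⟨X, hX, rfl⟩ h
  rw [← condExp_unit_mul, coeff_condExp φ hφ (hle X hX)]
  exact (mem_J_iff h𝒳 a).1 ha X hX _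

/-- Translates by elements of `φ(H)` reduce to the hypothesis on `b`; all other translates are
killed by the expectation. -/
theorem reducedMap_mem_J (hφ : Function.Injective φ) (h𝒳 : ConjInvariant 𝒳)
    (hle : ∀ X ∈ 𝒳, X ≤ φ.range) {b : ReducedCStar H} (hb : b ∈ J (Subgroup.comap φ '' 𝒳)) :
    reducedMap φ b ∈ J 𝒳 := by
  rw [mem_J_iff h𝒳]
  intro X hX g
  rw [← coeff_condExp φ hφ (hle X hX)]
  by_cases hg : g ∈ Set.range φ
  · obtain ⟨k, rfl⟩ := hg
    rw [condExp_unit_mul, condExp_reducedMap]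
    exact (mem_J_iff (h𝒳.comap φ) b).1 hb _ ⟨X, hX, rfl⟩ k
  · rw [condExp_unit_mul_reducedMap_of_notMem φ hφ hg, map_zero]

/-- Density of `J ∩ ℂ[G]` in `J` passes to a subgroup containing all members of `𝒳`. -/
theorem density_comap (hφ : Function.Injective φ) (h𝒳 : ConjInvariant 𝒳)
    (hle : ∀ X ∈ 𝒳, X ≤ φ.range)
    (hd : (J 𝒳 : Set (ReducedCStar G)) ⊆
      closure ((J 𝒳 : Set (ReducedCStar G)) ∩ Set.range (toReduced G))) :
    (J (Subgroup.comap φ '' 𝒳) : Set (ReducedCStar H)) ⊆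
      closure ((J (Subgroup.comap φ '' 𝒳) : Set (ReducedCStar H)) ∩
        Set.range (toReduced H)) := by
  intro b hb
  -- Include `b` in the larger algebra, approximate it there, and project back.
  rw [← condExp_reducedMap φ hφ b]
  refine map_mem_closure (condExp φ hφ).continuous
    (hd (reducedMap_mem_J φ hφ h𝒳 hle hb)) ?_
  rintro _ ⟨hf, f, rfl⟩
  exact ⟨condExp_mem_J φ hφ h𝒳 hle hf, _, (condExp_toReduced φ hφ f).symm⟩

end Restriction

/-! ### Elementary tensors in `ℓ²(A × B)` -/

section Tensor

variable {A B : Type*}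

theorem memlp_tensor (ξ : Ell2 A) (η : Ell2 B) :
    Memℓp (E := fun _ : A × B => ℂ) (fun p => ξ p.1 * η p.2) 2 := by
  refine memℓp_gen ?_
  have := (ell2_summable ξ).mul_of_nonneg (ell2_summable η) (fun _ => by positivity)
    fun _ => by positivity
  refine this.congr fun p => ?_
  simp [mul_pow]

/-- The elementary tensor `ξ ⊗ η` in `ℓ²(A × B)`. -/
def tensor (ξ : Ell2 A) (η : Ell2 B) : Ell2 (A × B) := ⟨_, memlp_tensor ξ η⟩

theorem tensor_apply (ξ : Ell2 A) (η : Ell2 B) (p : A × B) : tensor ξ η p = ξ p.1 * η p.2 := rfl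

theorem inner_tensor (ξ ξ' : Ell2 A) (η η' : Ell2 B) :
    inner ℂ (tensor ξ η) (tensor ξ' η') = inner ℂ ξ ξ' * inner ℂ η η' := by
  have h1 : Summable fun a => inner ℂ (ξ a) (ξ' a) := lp.summable_inner ξ ξ'
  have h2 : Summable fun b => inner ℂ (η b) (η' b) := lp.summable_inner η η'
  rw [lp.inner_eq_tsum, lp.inner_eq_tsum ξ, lp.inner_eq_tsum η]
  refine Eq.trans (tsum_congr fun p => ?_) (tsum_mul_tsum_of_summable_norm h1.norm h2.norm).symm
  simp only [tensor_apply, RCLike.inner_apply, map_mul]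
  ring

theorem norm_tensor (ξ : Ell2 A) (η : Ell2 B) : ‖tensor ξ η‖ = ‖ξ‖ * ‖η‖ := by
  rw [← sq_eq_sq₀ (norm_nonneg _) (by positivity), mul_pow, ell2_norm_sq, ell2_norm_sq,
    ell2_norm_sq, tsum_mul_tsum_of_summable_norm (ell2_summable ξ).norm (ell2_summable η).norm]
  exact tsum_congr fun p => by rw [tensor_apply, norm_mul, mul_pow]

theorem permRep_tensor {G : Type*} [Group G] [MulAction G A] [MulAction G B] (g : G)
    (ξ : Ell2 A) (η : Ell2 B) :
    permRep (A × B) g (tensor ξ η) = tensor (permRep A g ξ) (permRep B g η) := rfl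

end Tensor

/-! ### Contractive Herz–Schur multipliers -/

section Multiplier

variable {G : Type*} [Group G] [AmenableGroup G]

theorem norm_extRep_le (S : Type*) [MulAction G S] (a : ReducedCStar G) :
    ‖extRep S a‖ ≤ ‖a‖ := by
  have := LinearMap.norm_extendOfNorm_apply_le (f := (algRep S).toLinearMap)
    (e := (toReduced G).toLinearMap) (denseRange_toReduced G) 1 (norm_algRep_le_toReduced S) a
  rwa [one_mul] at this

theorem extRep_unit (S : Type*) [MulAction G S] (g : G) : extRep S (unit g) = permRep S g := by
  rw [unit, extRep_toReduced, algRep_single, one_smul]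

/-- The matrix coefficient `a ↦ ⟨a η, η'⟩` on `C*_r(G)`. -/
def vectorFunctional (η η' : Ell2 G) : ReducedCStar G →L[ℂ] ℂ :=
  innerSL ℂ η' ∘L ContinuousLinearMap.apply ℂ (Ell2 G) η ∘L
    { toFun := Subtype.val, map_add' := fun _ _ => rfl, map_smul' := fun _ _ => rfl,
      cont := continuous_subtype_val }

/-- A Herz–Schur multiplier with a coefficient of a permutation representation as its symbol is
bounded by the square of the norm of the vector. -/
theorem norm_multiplier_le {S : Type*} [MulAction G S] (ξ : Ell2 S)
    (m : ReducedCStar G →L[ℂ] ReducedCStar G)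
    (hm : ∀ g, m (unit g) = inner ℂ ξ (permRep S g ξ) • unit g) (a : ReducedCStar G) :
    ‖m a‖ ≤ ‖ξ‖ ^ 2 * ‖a‖ := by
  -- `m(a)` is the compression of `a`, acting diagonally on `ℓ²(S × G)`, along `η ↦ ξ ⊗ η`. By
  -- amenability the diagonal action extends contractively to `C*_r(G)`.
  have key : ∀ η η' : Ell2 G, inner ℂ η' ((m a : Ell2 G →L[ℂ] Ell2 G) η) =
      inner ℂ (tensor ξ η') (extRep (S × G) a (tensor ξ η)) := by
    intro η η'
    have := reduced_ext (T₁ := vectorFunctional η η' ∘L m)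
      (T₂ := innerSL ℂ (tensor ξ η') ∘L
        ContinuousLinearMap.apply ℂ (Ell2 (S × G)) (tensor ξ η) ∘L extRep (S × G)) fun g => by
        change inner ℂ η' ((m (unit g) : Ell2 G →L[ℂ] Ell2 G) η) =
          inner ℂ (tensor ξ η') (extRep (S × G) (unit g) (tensor ξ η))
        rw [hm, extRep_unit, permRep_tensor, inner_tensor]
        change inner ℂ η' (inner ℂ ξ (permRep S g ξ) •
          ((unit g : ReducedCStar G) : Ell2 G →L[ℂ] Ell2 G) η) = _
        rw [inner_smul_right, coe_unit]
    exact congrArg (fun T => T a) this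
  change ‖(m a : Ell2 G →L[ℂ] Ell2 G)‖ ≤ _
  refine ContinuousLinearMap.opNorm_le_bound _ (by positivity) fun η => ?_
  set ζ := (m a : Ell2 G →L[ℂ] Ell2 G) η
  rcases (norm_nonneg ζ).eq_or_lt with h0 | h0
  · rw [← h0]
    positivity
  refine le_of_mul_le_mul_left ?_ h0
  have h1 : ‖ζ‖ * ‖ζ‖ = ‖inner ℂ ζ ζ‖ := by
    rw [inner_self_eq_norm_sq_to_K, norm_pow, sq]
    simp
  rw [h1, key]
  refine (norm_inner_le_norm _ _).trans ?_
  calc ‖tensor ξ ζ‖ * ‖extRep (S × G) a (tensor ξ η)‖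
      ≤ ‖tensor ξ ζ‖ * (‖a‖ * ‖tensor ξ η‖) := by
        gcongr
        exact ((extRep (S × G) a).le_opNorm _).trans (by gcongr; exact norm_extRep_le _ _)
    _ = ‖ζ‖ * (‖ξ‖ ^ 2 * ‖a‖ * ‖η‖) := by rw [norm_tensor, norm_tensor]; ring

end Multiplier

/-! ### Almost invariant vectors from Følner sets -/

section AlmostInvariant

/-- This turns `ℓ¹` almost invariance of a density into `ℓ²` almost invariance of its square root.
-/
theorem sq_sqrt_sub_sqrt_le {a b : ℝ} (ha : 0 ≤ a) (hb : 0 ≤ b) :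
    (√a - √b) ^ 2 ≤ |a - b| := by
  have h1 : a - b = (√a - √b) * (√a + √b) := by
    linear_combination -(Real.sq_sqrt ha) + Real.sq_sqrt hb
  rw [h1, abs_mul, ← sq_abs, sq]
  refine mul_le_mul_of_nonneg_left ?_ (abs_nonneg _)
  rw [abs_of_nonneg (by positivity : 0 ≤ √a + √b), abs_le]
  constructor <;> linarith [Real.sqrt_nonneg a, Real.sqrt_nonneg b]

open Classical in
theorem abs_card_sub_card_le {A : Type*} (s t : Finset A) :
    |(s.card : ℝ) - t.card| ≤ (symmDiff s t).card := by
  have h : ∀ s t : Finset A, (s.card : ℝ) ≤ t.card + (symmDiff s t).card := by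
    intro s t
    have : s ⊆ t ∪ symmDiff s t := by
      intro x hx
      by_cases hxt : x ∈ t <;> simp [Finset.mem_symmDiff, hx, hxt]
    exact_mod_cast (Finset.card_le_card this).trans (Finset.card_union_le _ _)
  rw [abs_sub_le_iff]
  constructor
  · linarith [h s t]
  · have := h t s
    rw [symmDiff_comm] at this
    linarith

open Classical in
/-- A Følner condition yields finitely supported almost invariant unit vectors in `ℓ²` of every
non-empty set on which an amenable group acts. -/
theorem exists_almost_invariant {G : Type*} [Group G] [AmenableGroup G] {S : Type*}
    [MulAction G S] (s₀ : S) (A : Finset G) {ε : ℝ} (hε : 0 < ε) :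
    ∃ ξ : Ell2 S, ‖ξ‖ = 1 ∧ (∃ T : Finset S, ∀ s, s ∉ T → ξ s = 0) ∧
      ∀ g ∈ A, ‖permRep S g ξ - ξ‖ ≤ ε := by
  -- The squared displacement of the vector will be at most `|gF ∆ F| / |F|`, hence `ε ^ 2`.
  obtain ⟨F, hne, hF⟩ := AmenableGroup.folner A (ε ^ 2) (by positivity)
  have hpos : (0 : ℝ) < F.card := by exact_mod_cast hne.card_pos
  let fib : Finset G → S → Finset G := fun E s => E.filter fun x => x • s₀ = s
  have hnn : ∀ E s, (0 : ℝ) ≤ (fib E s).card / F.card := fun E s =>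
    div_nonneg (Nat.cast_nonneg _) (Nat.cast_nonneg _)
  -- `ξ` is the square root of the image of the uniform measure on `F` under the orbit map `x ↦ x •
  -- s₀`.
  obtain ⟨ξ, hξ, hn⟩ := ell2_sum_single (F.image fun x => x • s₀)
    fun s => ((√((fib F s).card / F.card) : ℝ) : ℂ)
  have hξ' : ∀ s, ξ s = ((√((fib F s).card / F.card) : ℝ) : ℂ) := by
    intro s
    rw [hξ]
    split_ifs with hs
    · rfl
    · have : fib F s = ∅ := Finset.filter_eq_empty_iff.2 fun x hx h =>
        hs (Finset.mem_image.2 ⟨x, hx, h⟩)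
      simp [this]
  refine ⟨ξ, ?_, ⟨F.image fun x => x • s₀, fun s hs => by rw [hξ, if_neg hs]⟩, fun g hg => ?_⟩
  · have h1 : ‖ξ‖ ^ 2 = 1 := by
      have h2 : ∀ s, ‖((√((fib F s).card / F.card) : ℝ) : ℂ)‖ ^ 2 =
          ((fib F s).card : ℝ) / F.card := by
        intro s
        rw [Complex.norm_real, Real.norm_eq_abs, sq_abs, Real.sq_sqrt (hnn F s)]
      rw [hn, Finset.sum_congr rfl fun s _ => h2 s, ← Finset.sum_div, ← Nat.cast_sum,
        ← Finset.card_eq_sum_card_image (fun x : G => x • s₀) F, div_self hpos.ne']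
    exact (pow_eq_one_iff_of_nonneg (norm_nonneg _) two_ne_zero).1 h1
  · have hshift : ∀ s, (fib F (g⁻¹ • s)).card = (fib (F.image fun x => g * x) s).card := by
      intro s
      rw [← Finset.card_image_of_injective (fib F (g⁻¹ • s)) (mul_right_injective g)]
      congr 1
      ext x
      simp only [fib, Finset.mem_image, Finset.mem_filter]
      constructor
      · rintro ⟨y, ⟨hy, h⟩, rfl⟩
        exact ⟨⟨y, hy, rfl⟩, by rw [mul_smul, h, smul_inv_smul]⟩
      · rintro ⟨⟨y, hy, rfl⟩, h⟩
        exact ⟨y, ⟨hy, by rw [← h, mul_smul, inv_smul_smul]⟩, rfl⟩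
    set D := symmDiff (F.image fun x => g * x) F
    have hD : ∀ s, fib D s = symmDiff (fib (F.image fun x => g * x) s) (fib F s) := by
      intro s
      ext x
      simp only [fib, D, Finset.mem_filter, Finset.mem_symmDiff]
      tauto
    have hpt : ∀ s, ‖(permRep S g ξ - ξ) s‖ ^ 2 ≤ (fib D s).card / F.card := by
      intro s
      have h1 : (permRep S g ξ - ξ) s =
          ((√((fib (F.image fun x => g * x) s).card / F.card) -
            √((fib F s).card / F.card) : ℝ) : ℂ) := by
        change ξ (g⁻¹ • s) - ξ s = _
        rw [hξ', hξ', hshift, Complex.ofReal_sub]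
      rw [h1, Complex.norm_real, Real.norm_eq_abs, sq_abs]
      refine (sq_sqrt_sub_sqrt_le (hnn _ s) (hnn _ s)).trans ?_
      rw [← sub_div, abs_div, abs_of_pos hpos, hD]
      refine div_le_div_of_nonneg_right ?_ hpos.le
      convert abs_card_sub_card_le _ _
    rw [← sq_le_sq₀ (norm_nonneg _) hε.le, ell2_norm_sq]
    refine Real.tsum_le_of_sum_le (fun _ => by positivity) fun U => ?_
    refine (Finset.sum_le_sum fun s _ => hpt s).trans ?_
    rw [← Finset.sum_div, div_le_iff₀ hpos]
    refine le_trans ?_ (hF g hg)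
    have h2 : ∑ s ∈ U, (fib D s).card = (D.filter fun x => x • s₀ ∈ U).card := by
      rw [Finset.card_eq_sum_card_fiberwise (f := fun x : G => x • s₀) (t := U)]
      · refine Finset.sum_congr rfl fun s hs => ?_
        congr 1
        ext x
        simp only [fib, Finset.mem_filter]
        constructor
        · rintro ⟨h, rfl⟩
          exact ⟨⟨h, hs⟩, rfl⟩
        · rintro ⟨⟨h, -⟩, rfl⟩
          exact ⟨h, rfl⟩
      · intro x hx
        exact (Finset.mem_filter.1 hx).2
    rw [← Nat.cast_sum, h2]
    exact_mod_cast Finset.card_filter_le _ _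

end AlmostInvariant

/-! ### Weighted coset sums and ascent from a normal subgroup -/

section CosetSum

theorem toReduced_single_mul_unit {G : Type*} [Group G] (g h : G) (z : ℂ) :
    toReduced G (MonoidAlgebra.single g z) * unit h = z • unit (g * h) := by
  rw [unit, ← map_mul, MonoidAlgebra.single_mul_single, mul_one, toReduced_single]

variable {G : Type*} [Group G] (N : Subgroup G)

/-- The part of an element of `C*_r(G)` supported on one coset of `N`, with a weight. -/
def cosetTerm (z : ℂ) (c : G ⧸ N) : ReducedCStar G →L[ℂ] ReducedCStar G :=
  mulLeftCLM (toReduced G (MonoidAlgebra.single c.out z)) ∘L reducedMap N.subtype ∘L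
    condExp N.subtype N.subtype_injective ∘L mulLeftCLM (unit c.out⁻¹)

theorem cosetTerm_apply (z : ℂ) (c : G ⧸ N) (a : ReducedCStar G) :
    cosetTerm N z c a = toReduced G (MonoidAlgebra.single c.out z) * reducedMap N.subtype
      (condExp N.subtype N.subtype_injective (unit c.out⁻¹ * a)) := rfl

/-- The sum of the parts of an element of `C*_r(G)` over finitely many cosets of `N`, with
weights. -/
def cosetSum (T : Finset (G ⧸ N)) (ψ : G ⧸ N → ℂ) : ReducedCStar G →L[ℂ] ReducedCStar G :=
  ∑ c ∈ T, cosetTerm N (ψ c) c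

theorem cosetSum_apply (T : Finset (G ⧸ N)) (ψ : G ⧸ N → ℂ) (a : ReducedCStar G) :
    cosetSum N T ψ a = ∑ c ∈ T, cosetTerm N (ψ c) c a :=
  sum_apply T (fun c => cosetTerm N (ψ c) c) a

variable [AmenableGroup G]

open Classical in
theorem cosetTerm_unit (z : ℂ) (c : G ⧸ N) (g : G) :
    cosetTerm N z c (unit g) = if (g : G ⧸ N) = c then z • unit g else 0 := by
  rw [cosetTerm_apply, unit_mul]
  have hc : (g : G ⧸ N) = c ↔ c.out⁻¹ * g ∈ N := by
    rw [← QuotientGroup.eq, QuotientGroup.out_eq', eq_comm]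
  split_ifs with hg
  · have h1 : condExp N.subtype N.subtype_injective (unit (c.out⁻¹ * g)) =
        unit (⟨_, hc.1 hg⟩ : N) := condExp_unit_map N.subtype N.subtype_injective ⟨_, hc.1 hg⟩
    have h2 : reducedMap N.subtype (unit (⟨_, hc.1 hg⟩ : N)) = unit (c.out⁻¹ * g) :=
      reducedMap_unit N.subtype ⟨_, hc.1 hg⟩
    have h3 := toReduced_single_mul_unit c.out (c.out⁻¹ * g) z
    rw [mul_inv_cancel_left] at h3
    exact (congrArg (_ * ·) ((congrArg (reducedMap N.subtype) h1).trans h2)).trans h3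
  · have h1 : c.out⁻¹ * g ∉ Set.range N.subtype := by
      rintro ⟨x, hx⟩
      exact hg (hc.2 (hx ▸ x.2))
    have h2 := condExp_unit_of_notMem N.subtype N.subtype_injective h1
    exact (congrArg (_ * ·) ((congrArg (reducedMap N.subtype) h2).trans
      (map_zero (reducedMap N.subtype)))).trans (mul_zero _)

open Classical in
theorem cosetSum_unit (T : Finset (G ⧸ N)) (ψ : G ⧸ N → ℂ) (g : G) :
    cosetSum N T ψ (unit g) = if (g : G ⧸ N) ∈ T then ψ g • unit g else 0 := by
  rw [cosetSum_apply, Finset.sum_congr rfl fun c _ => cosetTerm_unit N (ψ c) c g,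
    Finset.sum_ite_eq]

open Classical in
/-- For a normal subgroup there are contractive weighted coset sums that almost fix a given finite
set of group elements. -/
theorem exists_cosetSum [N.Normal] (A : Finset G) {ε : ℝ} (hε : 0 < ε) :
    ∃ (T : Finset (G ⧸ N)) (ψ : G ⧸ N → ℂ), (∀ a, ‖cosetSum N T ψ a‖ ≤ ‖a‖) ∧
      ∀ g ∈ A, ‖cosetSum N T ψ (unit g) - unit g‖ ≤ ε := by
  obtain ⟨ξ, hn, ⟨U, hU⟩, hA⟩ := exists_almost_invariant (1 : G ⧸ N) A hε
  -- If `⟨ξ, gξ⟩ ≠ 0`, then `U` meets `gU`, so the coset of `g` lies in `U U⁻¹`.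
  let T : Finset (G ⧸ N) := (U ×ˢ U).image fun p => p.1 * p.2⁻¹
  let ψ : G ⧸ N → ℂ := fun c => inner ℂ ξ (permRep (G ⧸ N) c.out ξ)
  have hact : ∀ (g : G) (s : G ⧸ N), g • s = (g : G ⧸ N) * s := by
    intro g s
    obtain ⟨x, rfl⟩ := QuotientGroup.mk_surjective s
    rfl
  -- Normality enters here: `N` acts trivially on `G/N`, so the symbol is constant on cosets.
  have hrep : ∀ g : G, permRep (G ⧸ N) (g : G ⧸ N).out ξ = permRep (G ⧸ N) g ξ := by
    intro g
    ext s
    rw [permRep_apply, permRep_apply, hact, hact, QuotientGroup.mk_inv, QuotientGroup.mk_inv,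
      QuotientGroup.out_eq']
  have hm : ∀ g, cosetSum N T ψ (unit g) = inner ℂ ξ (permRep (G ⧸ N) g ξ) • unit g := by
    intro g
    rw [cosetSum_unit]
    split_ifs with hg
    · rw [← hrep]
    · rw [lp.inner_eq_tsum]
      have h0 : ∀ s, inner ℂ (ξ s) (permRep (G ⧸ N) g ξ s) = 0 := by
        intro s
        by_cases h1 : s ∈ U
        · have h2 : g⁻¹ • s ∉ U := by
            intro h2
            refine hg (Finset.mem_image.2 ⟨(s, g⁻¹ • s), Finset.mk_mem_product h1 h2, ?_⟩)
            simp [hact]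
          rw [permRep_apply, hU _ h2, inner_zero_right]
        · rw [hU _ h1, inner_zero_left]
      simp only [h0, tsum_zero, zero_smul]
  refine ⟨T, ψ, fun a => ?_, fun g hg => ?_⟩
  · have := norm_multiplier_le ξ _ hm a
    rwa [hn, one_pow, one_mul] at this
  · have h1 : inner ℂ ξ (permRep (G ⧸ N) g ξ) - 1 = inner ℂ ξ (permRep (G ⧸ N) g ξ - ξ) := by
      rw [inner_sub_right, inner_self_eq_norm_sq_to_K, hn]
      simp
    have h2 : cosetSum N T ψ (unit g) - unit g =
        (inner ℂ ξ (permRep (G ⧸ N) g ξ) - 1) • unit g := by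
      rw [hm, sub_smul, one_smul]
    rw [h2, h1, norm_smul]
    calc ‖inner ℂ ξ (permRep (G ⧸ N) g ξ - ξ)‖ * ‖unit g‖
        ≤ (‖ξ‖ * ‖permRep (G ⧸ N) g ξ - ξ‖) * 1 := by
          gcongr
          · exact norm_inner_le_norm _ _
          · exact norm_unit_le g
      _ ≤ ε := by
          rw [hn, one_mul, mul_one]
          exact hA g hg

/-- Every element of `C*_r(G)` is approximated by its weighted coset sums. -/
theorem exists_cosetSum_near [N.Normal] (a : ReducedCStar G) {ε : ℝ} (hε : 0 < ε) :
    ∃ (T : Finset (G ⧸ N)) (ψ : G ⧸ N → ℂ), ‖cosetSum N T ψ a - a‖ < ε := by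
  obtain ⟨f, hf⟩ := (denseRange_toReduced G).exists_dist_lt a (ε := ε / 3) (by positivity)
  rw [dist_eq_norm] at hf
  set C : ℝ := ∑ g ∈ f.coeff.support, ‖f.coeff g‖
  have hC : 0 ≤ C := Finset.sum_nonneg fun _ _ => norm_nonneg _
  -- `C + 1` rather than `C` keeps the tolerance meaningful when `f = 0`.
  obtain ⟨T, ψ, h1, h2⟩ := exists_cosetSum N f.coeff.support (ε := ε / 3 / (C + 1))
    (by positivity)
  refine ⟨T, ψ, ?_⟩
  have hsum : toReduced G f = ∑ g ∈ f.coeff.support, f.coeff g • unit g := by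
    conv_lhs => rw [← f.sum_coeff_single, Finsupp.sum, map_sum]
    exact Finset.sum_congr rfl fun g _ => toReduced_single g _
  have h3 : ‖cosetSum N T ψ (toReduced G f) - toReduced G f‖ < ε / 3 := by
    rw [hsum, map_sum, ← Finset.sum_sub_distrib]
    calc ‖∑ g ∈ f.coeff.support, (cosetSum N T ψ (f.coeff g • unit g) - f.coeff g • unit g)‖
        ≤ ∑ g ∈ f.coeff.support, ‖f.coeff g‖ * (ε / 3 / (C + 1)) := by
          refine norm_sum_le_of_le _ fun g hg => ?_
          rw [map_smul, ← smul_sub, norm_smul]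
          exact mul_le_mul_of_nonneg_left (h2 g hg) (norm_nonneg _)
      _ = C * (ε / 3 / (C + 1)) := by rw [← Finset.sum_mul]
      _ < (C + 1) * (ε / 3 / (C + 1)) := by
          refine mul_lt_mul_of_pos_right (by linarith) (by positivity)
      _ = ε / 3 := by field_simp
  have h4 : cosetSum N T ψ a - a = cosetSum N T ψ (a - toReduced G f) +
      (cosetSum N T ψ (toReduced G f) - toReduced G f) - (a - toReduced G f) := by
    rw [map_sub]
    abel
  rw [h4]
  have h5 := norm_sub_le (cosetSum N T ψ (a - toReduced G f) +
      (cosetSum N T ψ (toReduced G f) - toReduced G f)) (a - toReduced G f)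
  have h6 := norm_add_le (cosetSum N T ψ (a - toReduced G f))
      (cosetSum N T ψ (toReduced G f) - toReduced G f)
  have h7 := h1 (a - toReduced G f)
  linarith

/-- Density of `J ∩ ℂ[N]` in `J` for a normal subgroup `N` containing all members of `𝒳` implies
density for the whole group. -/
theorem density_of_normal [N.Normal] {𝒳 : Set (Subgroup G)} (h𝒳 : ConjInvariant 𝒳)
    (hle : ∀ X ∈ 𝒳, X ≤ N)
    (hd : (J (Subgroup.comap N.subtype '' 𝒳) : Set (ReducedCStar N)) ⊆
      closure ((J (Subgroup.comap N.subtype '' 𝒳) : Set (ReducedCStar N)) ∩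
        Set.range (toReduced N))) :
    (J 𝒳 : Set (ReducedCStar G)) ⊆
      closure ((J 𝒳 : Set (ReducedCStar G)) ∩ Set.range (toReduced G)) := by
  intro a ha
  have hr : ∀ X ∈ 𝒳, X ≤ N.subtype.range := by simpa using hle
  -- As an additive subgroup, `W` has a closure stable under the finite coset sums.
  let W : AddSubgroup (ReducedCStar G) :=
    (J 𝒳).toAddSubgroup ⊓ (toReduced G : MonoidAlgebra ℂ G →+ ReducedCStar G).range
  have hW : (J 𝒳 : Set (ReducedCStar G)) ∩ Set.range (toReduced G) = W := rfl
  have hmem : ∀ T ψ, cosetSum N T ψ a ∈ W.topologicalClosure := by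
    intro T ψ
    rw [cosetSum_apply]
    refine AddSubgroup.sum_mem _ fun c _ => ?_
    have hb : condExp N.subtype N.subtype_injective (unit c.out⁻¹ * a) ∈
        J (Subgroup.comap N.subtype '' 𝒳) :=
      condExp_mem_J _ N.subtype_injective h𝒳 hr ((J 𝒳).mul_mem_left _ ha)
    have hcont : Continuous fun b : ReducedCStar N =>
        toReduced G (MonoidAlgebra.single c.out (ψ c)) * reducedMap N.subtype b :=
      (mulLeftCLM (toReduced G (MonoidAlgebra.single c.out (ψ c)))).continuous.comp
        (reducedMap N.subtype).continuous
    rw [cosetTerm_apply]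
    refine map_mem_closure (x := condExp N.subtype N.subtype_injective (unit c.out⁻¹ * a)) hcont
      (hd hb) ?_
    rintro _ ⟨hf, f, rfl⟩
    refine ⟨(J 𝒳).mul_mem_left _ (reducedMap_mem_J _ N.subtype_injective h𝒳 hr hf),
      MonoidAlgebra.single c.out (ψ c) * MonoidAlgebra.mapDomainAlgHom ℂ ℂ N.subtype f, ?_⟩
    exact (map_mul (toReduced G) _ _).trans
      (congrArg _ (reducedMap_toReduced N.subtype f).symm)
  rw [hW]
  have hcl : IsClosed (closure (W : Set (ReducedCStar G))) := isClosed_closure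
  -- The coset sums lie only in the closure of `W`, so a second closure is inserted before
  -- approximating `a` by them.
  rw [← hcl.closure_eq, Metric.mem_closure_iff]
  intro ε hε
  obtain ⟨T, ψ, h⟩ := exists_cosetSum_near N a hε
  exact ⟨_, hmem T ψ, by rwa [dist_comm, dist_eq_norm]⟩

end CosetSum

/-! ### Closedness and the normal subgroup generated by `𝒳` -/

section Transfer

variable {G : Type*} [Group G]

/-- The image equals the preimage of `𝒳` under the continuous map regarding a subgroup of `Λ` as a
subgroup of `G`. -/
theorem isClosed_image_subgroupOf {𝒳 : Set (Subgroup G)} (h : IsClosed[chabauty G] 𝒳)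
    (Λ : Subgroup G) (hΛ : ∀ X ∈ 𝒳, X ≤ Λ) :
    IsClosed[chabauty Λ] ((fun X : Subgroup G => X.subgroupOf Λ) '' 𝒳) := by
  classical
  let := chabauty G
  let := chabauty Λ
  have hcont : Continuous fun Y : Subgroup Λ => Y.map Λ.subtype := by
    refine continuous_induced_rng.2 (continuous_pi fun g => ?_)
    by_cases hg : g ∈ Λ
    · have h1 : Continuous fun Y : Subgroup Λ => decide ((⟨g, hg⟩ : Λ) ∈ Y) := by
        have h2 : Continuous fun (Y : Subgroup Λ) (l : Λ) => decide (l ∈ Y) := by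
          convert continuous_induced_dom
        exact (continuous_apply (⟨g, hg⟩ : Λ)).comp h2
      convert h1 using 2 with Y
      simp [hg]
    · convert continuous_const (y := false) using 2 with Y
      simp [hg]
  convert h.preimage hcont using 1
  ext Y
  constructor
  · rintro ⟨X, hX, rfl⟩
    change (X.subgroupOf Λ).map Λ.subtype ∈ 𝒳
    rwa [Subgroup.subgroupOf_map_subtype, inf_eq_left.2 (hΛ X hX)]
  · intro hY
    exact ⟨_, hY, Subgroup.comap_map_eq_self_of_injective Λ.subtype_injective Y⟩

/-- Conjugation maps the generating family `𝒳` into itself. -/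
theorem ConjInvariant.normal_sSup {𝒳 : Set (Subgroup G)} (h : ConjInvariant 𝒳) :
    (sSup 𝒳).Normal := by
  refine ⟨fun n hn g => ?_⟩
  have hle : sSup 𝒳 ≤ (sSup 𝒳).comap (MulAut.conj g).toMonoidHom := by
    refine sSup_le fun X hX => ?_
    rw [← Subgroup.map_le_iff_le_comap]
    exact le_sSup (h g X hX)
  exact hle hn

end Transfer

end GroupCStar

end

theorem theorem3p6 {Γ : Type*} [Group Γ] [AmenableGroup Γ] (𝒳 : Set (Subgroup Γ))
    (h_closed : @IsClosed _ (GroupCStar.chabauty Γ) 𝒳) (h_conj : GroupCStar.ConjInvariant 𝒳)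
    (Λ : Subgroup Γ) (hΛ : ∀ X ∈ 𝒳, X ≤ Λ) :
    𝒳 ∈ GroupCStar.DensityClass Γ ↔
      (fun X : Subgroup Γ => X.subgroupOf Λ) '' 𝒳 ∈ GroupCStar.DensityClass Λ := by
  constructor
  · rintro ⟨-, -, hd⟩
    exact ⟨GroupCStar.isClosed_image_subgroupOf h_closed Λ hΛ, h_conj.comap Λ.subtype,
      GroupCStar.density_comap Λ.subtype Λ.subtype_injective h_conj (by simpa using hΛ) hd⟩
  · rintro ⟨-, hc, hd⟩
    have hN := h_conj.normal_sSup
    have hNΛ : sSup 𝒳 ≤ Λ := sSup_le hΛ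
    refine ⟨h_closed, h_conj, GroupCStar.density_of_normal (sSup 𝒳) h_conj
      (fun X hX => le_sSup hX) ?_⟩
    -- `Λ` need not be normal, so density first descends from `Λ` to the normal subgroup `sSup 𝒳`.
    have key := GroupCStar.density_comap (Subgroup.inclusion hNΛ)
      (Subgroup.inclusion_injective hNΛ) hc (by
        rintro _ ⟨X, hX, rfl⟩ x hx
        exact ⟨⟨x, le_sSup hX hx⟩, rfl⟩) hd
    have himg : Subgroup.comap (Subgroup.inclusion hNΛ) ''
        ((fun X : Subgroup Γ => X.subgroupOf Λ) '' 𝒳) =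
        Subgroup.comap (sSup 𝒳).subtype '' 𝒳 := by
      rw [Set.image_image]
      rfl
    rwa [himg] at key
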